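/- Let $L(Q_0)$ be first-order logic with equality extended by the quantifier $Q_0$, where $\mathfrak M\models Q_0x\,\psi(x)$ if and only if $\{a\in M:\mathfrak M\models\psi(a)\}$ is infinite. Structures have nonempty domains, and relation and function symbols (constants being $0$-ary function symbols) are drawn from a fixed supply with infinitely many symbols of each kind and arity; $\tau(\varphi)$ denotes the set of non-logical symbols occurring in $\varphi$. The weak Beth property for $L(Q_0)$ says the following. Let $\varphi$ be a sentence of $L(Q_0)$ and $P\in\tau(\varphi)$ a relation symbol of arity $n$ such that (a) $\varphi$ defines $P$ implicitly: any two models of $\varphi$ with the same domain and the same interpretation of all symbols in $\tau(\varphi)\setminus\{P\}$ interpret $P$ in the same way; and (b) every structure of vocabulary $\tau(\varphi)\setminus\{P\}$ can be expanded to a model of $\varphi$. Then there is a formula $\theta(x_1,\dots,x_n)$ of $L(Q_0)$ with $P\notin\tau(\theta)$ such that $\varphi\models\forall x_1\cdots\forall x_n\,(P(x_1,\dots,x_n)\leftrightarrow\theta(x_1,\dots,x_n))$. **Theorem.** The logic $L(Q_0)$ does not have the weak Beth property. -/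

import Mathlib

universe u v w x

namespace LQ0

variable {L : FirstOrder.Language.{u, v}} {α : Type x}

/-- Formulas of the logic `L(Q₀)` over the symbols of `L`, with equality, with free variables
indexed by `α` and `k` further de Bruijn variables indexed by `Fin k`, in the style of
Mathlib's `FirstOrder.Language.BoundedFormula`. The constructor `inf` is the quantifier `Q₀`,
"there are infinitely many". The other connectives and `∃` are defined from `falsum`, `imp`
and `all` as usual. -/
inductive BoundedFormula (L : FirstOrder.Language.{u, v}) (α : Type x) : ℕ → Type (max u v x)
  | falsum {k : ℕ} : BoundedFormula L α k
  | equal {k : ℕ} (t₁ t₂ : L.Term (α ⊕ Fin k)) : BoundedFormula L α k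
  | rel {k l : ℕ} (R : L.Relations l) (ts : Fin l → L.Term (α ⊕ Fin k)) : BoundedFormula L α k
  | imp {k : ℕ} (f₁ f₂ : BoundedFormula L α k) : BoundedFormula L α k
  | all {k : ℕ} (f : BoundedFormula L α (k + 1)) : BoundedFormula L α k
  | inf {k : ℕ} (f : BoundedFormula L α (k + 1)) : BoundedFormula L α k

/-- Formulas of `L(Q₀)` with free variables in `α`. -/
abbrev Formula (L : FirstOrder.Language.{u, v}) (α : Type x) := BoundedFormula L α 0

/-- Sentences of `L(Q₀)`. -/
abbrev Sentence (L : FirstOrder.Language.{u, v}) := Formula L Empty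

/-- The satisfaction relation of `L(Q₀)`. -/
def BoundedFormula.Realize {M : Type w} (A : L.Structure M) :
    {k : ℕ} → BoundedFormula L α k → (α → M) → (Fin k → M) → Prop
  | _, .falsum, _, _ => False
  | _, .equal t₁ t₂, v, xs => t₁.realize (Sum.elim v xs) = t₂.realize (Sum.elim v xs)
  | _, .rel R ts, v, xs => A.RelMap R fun i => (ts i).realize (Sum.elim v xs)
  | _, .imp f₁ f₂, v, xs => f₁.Realize A v xs → f₂.Realize A v xs
  | _, .all f, v, xs => ∀ a : M, f.Realize A v (Fin.snoc xs a)
  | _, .inf f, v, xs => {a : M | f.Realize A v (Fin.snoc xs a)}.Infinite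

/-- The formula `θ` is satisfied in the structure `A` by the assignment `v`. -/
def Formula.Realize {M : Type w} (A : L.Structure M) (θ : Formula L α) (v : α → M) : Prop :=
  BoundedFormula.Realize A θ v Fin.elim0

/-- The sentence `φ` is true in the structure `A`. -/
def Sentence.Realize {M : Type w} (A : L.Structure M) (φ : Sentence L) : Prop :=
  Formula.Realize A φ Empty.elim

/-- The set of (function and constant) symbols occurring in a term. -/
def termVocab : L.Term α → Set L.Symbols
  | .var _ => ∅
  | .func f ts => {Sum.inl ⟨_, f⟩} ∪ ⋃ i, termVocab (ts i)

/-- The vocabulary `τ(φ)` of a formula: the set of non-logical symbols occurring in it. -/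
def BoundedFormula.vocab : {k : ℕ} → BoundedFormula L α k → Set L.Symbols
  | _, .falsum => ∅
  | _, .equal t₁ t₂ => termVocab t₁ ∪ termVocab t₂
  | _, .rel R ts => {Sum.inr ⟨_, R⟩} ∪ ⋃ i, termVocab (ts i)
  | _, .imp f₁ f₂ => f₁.vocab ∪ f₂.vocab
  | _, .all f => f.vocab
  | _, .inf f => f.vocab

/-- A relation symbol, regarded as a symbol. -/
def relSymbol {n : ℕ} (P : L.Relations n) : L.Symbols := Sum.inr ⟨n, P⟩

/-- Two structures with the same domain have the same reduct to the vocabulary `σ`. -/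
def SameReduct {M : Type w} (σ : Set L.Symbols) (A B : L.Structure M) : Prop :=
  (∀ (l : ℕ) (f : L.Functions l), Sum.inl ⟨l, f⟩ ∈ σ → ∀ a, A.funMap f a = B.funMap f a) ∧
  (∀ (l : ℕ) (R : L.Relations l), Sum.inr ⟨l, R⟩ ∈ σ → ∀ a, A.RelMap R a ↔ B.RelMap R a)

/-- `φ` defines `P` implicitly: any two models of `φ` with the same domain and the same
interpretation of the symbols of `φ` other than `P` interpret `P` in the same way. -/
def ImplicitlyDefines {n : ℕ} (φ : Sentence L) (P : L.Relations n) : Prop :=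
  ∀ (M : Type w) [Nonempty M] (A B : L.Structure M),
    SameReduct (φ.vocab \ {relSymbol P}) A B →
    Sentence.Realize A φ → Sentence.Realize B φ →
    ∀ a : Fin n → M, A.RelMap P a ↔ B.RelMap P a

/-- Every structure for the vocabulary `τ(φ) \ {P}` can be expanded to a model of `φ`. A structure
for `τ(φ) \ {P}` is given as the reduct of an arbitrary structure `A` for all symbols of `L`. -/
def EveryReductExpands {n : ℕ} (φ : Sentence L) (P : L.Relations n) : Prop :=
  ∀ (M : Type w) [Nonempty M] (A : L.Structure M),
    ∃ B : L.Structure M, SameReduct (φ.vocab \ {relSymbol P}) A B ∧ Sentence.Realize B φ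

/-- `P` is explicitly definable in the models of `φ` by a formula of `L(Q₀)` in which `P` does
not occur. -/
def ExplicitlyDefines {n : ℕ} (φ : Sentence L) (P : L.Relations n) : Prop :=
  ∃ θ : Formula L (Fin n), relSymbol P ∉ θ.vocab ∧
    ∀ (M : Type w) [Nonempty M] (A : L.Structure M), Sentence.Realize A φ →
      ∀ a : Fin n → M, A.RelMap P a ↔ Formula.Realize A θ a

/-- The weak Beth property of the logic `L(Q₀)`, where the non-logical symbols of sentences and
structures are drawn from the supply `L` and domains of structures are the nonempty types of
`Type w`. -/
def WeakBeth (L : FirstOrder.Language.{u, v}) : Prop :=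
  ∀ (n : ℕ) (P : L.Relations n) (φ : Sentence L), relSymbol P ∈ φ.vocab →
    ImplicitlyDefines.{u, v, w} φ P → EveryReductExpands.{u, v, w} φ P →
    ExplicitlyDefines.{u, v, w} φ P

end LQ0

open FirstOrder

namespace LQ0

/-! The counterexample says that `P` is the kernel of `R`: a point is in `P` when `R` is a strict
partial order with finite initial segments and no immediate predecessor of the point is in `P`.
Finiteness is expressible with Q₀ and gives well-foundedness, so recursion yields exactly one such
`P` over every `R` (`IsKernel.unique`, `exists_isKernel`). On (ℕ, <) the kernel is the set of even
numbers (`isKernel_even`). A back-and-forth argument (`exists_shift_realize_iff`) shows that a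
formula without `P` cannot separate N from N + 1 for suitable N, so parity has no explicit
definition. -/

section Connectives

variable {L : FirstOrder.Language.{u, v}} {α : Type x} {k : ℕ}

/-- Negation. -/
def BoundedFormula.neg (f : BoundedFormula L α k) : BoundedFormula L α k := .imp f .falsum

/-- Conjunction. -/
def BoundedFormula.conj (f g : BoundedFormula L α k) : BoundedFormula L α k := (f.imp g.neg).neg

/-- The biconditional. -/
def BoundedFormula.biimp (f g : BoundedFormula L α k) : BoundedFormula L α k :=
  (f.imp g).conj (g.imp f)

variable {M : Type w} (A : L.Structure M) (f g : BoundedFormula L α k) (v : α → M) (xs : Fin k → M)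

theorem realize_neg : f.neg.Realize A v xs ↔ ¬ f.Realize A v xs := Iff.rfl

theorem realize_conj : (f.conj g).Realize A v xs ↔ f.Realize A v xs ∧ g.Realize A v xs := by
  simp [BoundedFormula.conj, BoundedFormula.neg, BoundedFormula.Realize]

theorem realize_biimp : (f.biimp g).Realize A v xs ↔ (f.Realize A v xs ↔ g.Realize A v xs) := by
  simp only [BoundedFormula.biimp, realize_conj, BoundedFormula.Realize]
  exact iff_def.symm

end Connectives

/-! ### Reinterpreting one relation symbol -/

section Update

variable {L : FirstOrder.Language.{u, v}} {M : Type w} {n : ℕ}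

open Classical in
/-- The structure obtained from `A` by reinterpreting the relation symbol `P` as `p`. -/
@[reducible] def withRel (A : L.Structure M) (P : L.Relations n) (p : (Fin n → M) → Prop) : L.Structure M where
  funMap := A.funMap
  RelMap {l} r xs :=
    if h : (⟨l, r⟩ : Σ l, L.Relations l) = ⟨n, P⟩ then
      p fun i => xs (Fin.cast (congrArg Sigma.fst h).symm i)
    else A.RelMap r xs

theorem withRel_relMap_self (A : L.Structure M) (P : L.Relations n) (p : (Fin n → M) → Prop)
    (xs : Fin n → M) : (withRel A P p).RelMap P xs ↔ p xs :=
  iff_of_eq (dif_pos rfl)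

theorem withRel_relMap_of_ne (A : L.Structure M) (P : L.Relations n) (p : (Fin n → M) → Prop)
    {l : ℕ} {r : L.Relations l} (h : relSymbol r ≠ relSymbol P) (xs : Fin l → M) :
    (withRel A P p).RelMap r xs ↔ A.RelMap r xs := by
  have h' : (⟨l, r⟩ : Σ l, L.Relations l) ≠ ⟨n, P⟩ := fun e => h (congrArg Sum.inr e)
  exact iff_of_eq (dif_neg h')

theorem sameReduct_withRel (A : L.Structure M) (P : L.Relations n) (p : (Fin n → M) → Prop)
    (σ : Set L.Symbols) : SameReduct (σ \ {relSymbol P}) A (withRel A P p) :=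
  ⟨fun _ _ _ _ => rfl, fun _ _ h xs => (withRel_relMap_of_ne A P p h.2 xs).symm⟩

theorem relSymbol_ne_of_ne {m n : ℕ} (h : m ≠ n) (R : L.Relations m) (P : L.Relations n) :
    relSymbol R ≠ relSymbol P := fun e => h (congrArg Sigma.fst (Sum.inr.inj e))

end Update

/-! ### Kernels of finitary orders -/

section Kernel

variable {M : Type w}

/-- `r` is a strict partial order with finite initial segments. -/
def FinitaryOrder (r : M → M → Prop) : Prop :=
  (∀ a, ¬ r a a) ∧ (∀ a b c, r a b → r b c → r a c) ∧ ∀ a, {b | r b a}.Finite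

/-- The size of the initial segment is a rank in ℕ: transitivity gives inclusion of segments,
irreflexivity makes it strict. -/
theorem FinitaryOrder.wellFounded {r : M → M → Prop} (h : FinitaryOrder r) : WellFounded r := by
  refine Subrelation.wf (r := InvImage (· < ·) fun a => {b | r b a}.ncard) (fun {a b} hab => ?_)
    (InvImage.wf _ wellFounded_lt)
  refine Set.ncard_lt_ncard ⟨fun c hc => h.2.1 c a b hc hab, fun hs => h.1 a (hs hab)⟩ (h.2.2 b)

/-- `b` is an immediate predecessor of `a`. -/
def ImmPred (r : M → M → Prop) (b a : M) : Prop := r b a ∧ ∀ c, r b c → ¬ r c a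

/-- `p` holds at exactly those points of a finitary order none of whose immediate predecessors
satisfies `p`, and it is empty if `r` is not a finitary order. -/
def IsKernel (r : M → M → Prop) (p : M → Prop) : Prop :=
  ∀ a, p a ↔ FinitaryOrder r ∧ ∀ b, ImmPred r b a → ¬ p b

theorem IsKernel.unique {r : M → M → Prop} {p q : M → Prop} (hp : IsKernel r p)
    (hq : IsKernel r q) (a : M) : p a ↔ q a := by
  by_cases h : FinitaryOrder r
  · induction a using h.wellFounded.induction with
    | _ a ih =>
      rw [hp, hq]
      exact and_congr_right fun _ => forall_congr' fun b => imp_congr_right fun hb =>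
        not_congr (ih b hb.1)
  · rw [hp, hq]
    simp [h]

theorem exists_isKernel (r : M → M → Prop) : ∃ p, IsKernel r p := by
  by_cases h : FinitaryOrder r
  · refine ⟨h.wellFounded.fix fun a ih => ∀ b (hb : ImmPred r b a), ¬ ih b hb.1, fun a => ?_⟩
    rw [h.wellFounded.fix_eq]
    simp [h]
  · exact ⟨fun _ => False, fun a => by simp [h]⟩

end Kernel

/-! ### The implicit definition -/

section KernelSentence

variable {L : FirstOrder.Language.{u, v}}

/-- The atomic formula saying that the binary relation `R` holds of the variables `i` and `j`. -/
def rel₂ (R : L.Relations 2) {k : ℕ} (i j : Fin k) : BoundedFormula L Empty k :=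
  .rel R ![.var (.inr i), .var (.inr j)]

/-- The atomic formula saying that the unary relation `P` holds of the variable `i`. -/
def rel₁ (P : L.Relations 1) {k : ℕ} (i : Fin k) : BoundedFormula L Empty k :=
  .rel P ![.var (.inr i)]

theorem realize_rel₂ {M : Type w} (A : L.Structure M) (R : L.Relations 2) {k : ℕ} (i j : Fin k)
    (v : Empty → M) (xs : Fin k → M) :
    (rel₂ R i j).Realize A v xs ↔ A.RelMap R ![xs i, xs j] := by
  refine iff_of_eq (congrArg (A.RelMap R) (funext fun l => ?_))
  fin_cases l <;> rfl

theorem realize_rel₁ {M : Type w} (A : L.Structure M) (P : L.Relations 1) {k : ℕ} (i : Fin k)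
    (v : Empty → M) (xs : Fin k → M) :
    (rel₁ P i).Realize A v xs ↔ A.RelMap P ![xs i] := by
  refine iff_of_eq (congrArg (A.RelMap P) (funext fun l => ?_))
  fin_cases l
  rfl

/-- The sentence saying that `P` is the kernel of `R` in the sense of `IsKernel`. -/
def kernelSentence (R : L.Relations 2) (P : L.Relations 1) : Sentence L :=
  .all <| (rel₁ P 0).biimp <|
    ((BoundedFormula.all (rel₂ R 1 1).neg).conj <|
      (BoundedFormula.all <| .all <| .all <|
        (rel₂ R 1 2).imp <| (rel₂ R 2 3).imp <| rel₂ R 1 3).conj <|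
      -- The only use of Q₀: initial segments are finite.
      .all <| (BoundedFormula.inf (rel₂ R 2 1)).neg).conj <|
    .all <| ((rel₂ R 1 0).conj <| .all <| (rel₂ R 1 2).imp (rel₂ R 2 0).neg).imp (rel₁ P 1).neg

theorem realize_kernelSentence {M : Type w} (A : L.Structure M) (R : L.Relations 2)
    (P : L.Relations 1) : Sentence.Realize A (kernelSentence R P) ↔
      IsKernel (fun a b => A.RelMap R ![a, b]) fun a => A.RelMap P ![a] := by
  simp only [Sentence.Realize, Formula.Realize, kernelSentence, BoundedFormula.Realize,
    realize_biimp, realize_conj, realize_neg, realize_rel₁, realize_rel₂, Set.not_infinite]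
  rfl

theorem relSymbol_mem_vocab_kernelSentence (R : L.Relations 2) (P : L.Relations 1) :
    relSymbol R ∈ (kernelSentence R P).vocab ∧ relSymbol P ∈ (kernelSentence R P).vocab := by
  simp [kernelSentence, BoundedFormula.biimp, BoundedFormula.conj, BoundedFormula.neg, rel₁, rel₂,
    BoundedFormula.vocab, relSymbol]

theorem implicitlyDefines_kernelSentence (R : L.Relations 2) (P : L.Relations 1) :
    ImplicitlyDefines.{u, v, w} (kernelSentence R P) P := by
  intro M _ A B hAB hA hB a
  rw [realize_kernelSentence] at hA hB
  have hR : (fun a b => A.RelMap R ![a, b]) = fun a b => B.RelMap R ![a, b] := by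
    funext a b
    exact propext (hAB.2 2 R ⟨(relSymbol_mem_vocab_kernelSentence R P).1,
      relSymbol_ne_of_ne (by decide) R P⟩ _)
  have ha : a = ![a 0] := by
    funext i
    fin_cases i
    rfl
  rw [ha]
  exact (hR ▸ hA).unique hB (a 0)

theorem isKernel_withRel {M : Type w} (A : L.Structure M) (R : L.Relations 2)
    (P : L.Relations 1) {p : M → Prop} (hp : IsKernel (fun a b => A.RelMap R ![a, b]) p) :
    Sentence.Realize (withRel A P fun xs => p (xs 0)) (kernelSentence R P) := by
  rw [realize_kernelSentence]
  simp only [withRel_relMap_self, withRel_relMap_of_ne A P _ (relSymbol_ne_of_ne (by decide) R P)]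
  exact hp

theorem everyReductExpands_kernelSentence (R : L.Relations 2) (P : L.Relations 1) :
    EveryReductExpands.{u, v, w} (kernelSentence R P) P := by
  intro M _ A
  obtain ⟨p, hp⟩ := exists_isKernel fun a b => A.RelMap R ![a, b]
  exact ⟨_, sameReduct_withRel A P _ _, isKernel_withRel A R P hp⟩

end KernelSentence

/-! ### Parity is not definable from the order of ℕ -/

section Undefinability

/-- `y` arises from `x` by fixing the numbers up to `c` and adding one to those from `c + N` on. -/
def Shift (c N : ℕ) (x y : ULift.{w} ℕ) : Prop :=
  (x.down ≤ c ∧ y.down = x.down) ∨ (c + N ≤ x.down ∧ y.down = x.down + 1)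

theorem Shift.mono {c N N' : ℕ} (hN : N ≤ N') {x y : ULift.{w} ℕ} (h : Shift c N' x y) :
    Shift c N x y := by
  unfold Shift at *
  omega

/-- Positivity of `N` matters: with `N = 0` the point `c` could be both fixed and moved. -/
theorem Shift.lt_iff {c N : ℕ} (hN : 0 < N) {x y x' y' : ULift.{w} ℕ} (h : Shift c N x y)
    (h' : Shift c N x' y') : x.down < x'.down ↔ y.down < y'.down := by
  unfold Shift at *
  omega

theorem Shift.eq_iff {c N : ℕ} (hN : 0 < N) {x y x' y' : ULift.{w} ℕ} (h : Shift c N x y)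
    (h' : Shift c N x' y') : x = x' ↔ y = y' := by
  rw [← ULift.down_inj, ← ULift.down_inj]
  unfold Shift at *
  omega

variable {L : FirstOrder.Language.{u, v}} {α : Type x}

theorem Shift.realize_term {A : L.Structure (ULift.{w} ℕ)}
    (hA : ∀ {l} (f : L.Functions l) xs, A.funMap f xs = ⟨0⟩) {c N : ℕ} {e e' : α → ULift.{w} ℕ}
    (h : ∀ i, Shift c N (e i) (e' i)) (t : L.Term α) :
    Shift c N (t.realize e) (t.realize e') := by
  cases t with
  | var i => exact h i
  | func f ts =>
    simp only [Language.Term.realize, hA]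
    exact .inl ⟨Nat.zero_le _, rfl⟩

/-- Finite shifts above a sufficiently large gap preserve a given formula, in structures on the
natural numbers whose functions are zero and whose relations depend only on the order. -/
theorem exists_shift_realize_iff {A : L.Structure (ULift.{w} ℕ)} {σ : Set L.Symbols}
    (hf : ∀ {l} (f : L.Functions l) xs, A.funMap f xs = ⟨0⟩)
    (hr : ∀ {l} (r : L.Relations l), relSymbol r ∈ σ → ∀ xs ys : Fin l → ULift.{w} ℕ,
      (∀ i j, (xs i).down < (xs j).down ↔ (ys i).down < (ys j).down) →
        (A.RelMap r xs ↔ A.RelMap r ys))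
    {k : ℕ} (f : BoundedFormula L α k) (hσ : f.vocab ⊆ σ) :
    ∃ N : ℕ, ∀ (c : ℕ) (v v' : α → ULift.{w} ℕ) (xs xs' : Fin k → ULift.{w} ℕ),
      (∀ i, Shift c N (v i) (v' i)) → (∀ i, Shift c N (xs i) (xs' i)) →
        (f.Realize A v xs ↔ f.Realize A v' xs') := by
  have elim {k : ℕ} {c N : ℕ} {v v' : α → ULift.{w} ℕ} {xs xs' : Fin k → ULift.{w} ℕ}
      (h : ∀ i, Shift c N (v i) (v' i)) (h' : ∀ i, Shift c N (xs i) (xs' i)) :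
      ∀ i, Shift c N (Sum.elim v xs i) (Sum.elim v' xs' i) := by
    rintro (i | i)
    exacts [h i, h' i]
  have snoc {k : ℕ} {c N : ℕ} {xs xs' : Fin k → ULift.{w} ℕ} {a a' : ULift.{w} ℕ}
      (h : ∀ i, Shift c N (xs i) (xs' i)) (h' : Shift c N a a') :
      ∀ i, Shift c N (Fin.snoc (α := fun _ => ULift.{w} ℕ) xs a i)
        (Fin.snoc (α := fun _ => ULift.{w} ℕ) xs' a' i) := by
    intro i
    induction i using Fin.lastCases with
    | last => simpa using h'
    | cast i => simpa using h i
  have left {c N : ℕ} {x y : ULift.{w} ℕ} (h : Shift c (2 * N) x y) : Shift (c + N) N x y := by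
    unfold Shift at *
    omega
  induction f with
  | falsum => exact ⟨1, fun _ _ _ _ _ _ _ => Iff.rfl⟩
  | equal t₁ t₂ =>
    exact ⟨1, fun c v v' xs xs' h h' =>
      (Shift.realize_term hf (elim h h') t₁).eq_iff one_pos (Shift.realize_term hf (elim h h') t₂)⟩
  | rel r ts =>
    refine ⟨1, fun c v v' xs xs' h h' => hr r (hσ (.inl rfl)) _ _ fun i j => ?_⟩
    exact (Shift.realize_term hf (elim h h') _).lt_iff one_pos
      (Shift.realize_term hf (elim h h') _)
  | imp f g ihf ihg =>
    obtain ⟨N₁, ihf⟩ := ihf (Set.subset_union_left.trans hσ)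
    obtain ⟨N₂, ihg⟩ := ihg (Set.subset_union_right.trans hσ)
    refine ⟨max N₁ N₂, fun c v v' xs xs' h h' => imp_congr ?_ ?_⟩
    · exact ihf c v v' xs xs' (fun i => (h i).mono (le_max_left _ _))
        fun i => (h' i).mono (le_max_left _ _)
    · exact ihg c v v' xs xs' (fun i => (h i).mono (le_max_right _ _))
        fun i => (h' i).mono (le_max_right _ _)
  | all f ih =>
    obtain ⟨N, ih⟩ := ih hσ
    -- A gap of length 2N leaves room for one more element: up to c + N it is fixed, leaving the
    -- upper half as gap; from c + N on it moves by one, leaving the lower half.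
    refine ⟨2 * N, fun c v v' xs xs' h h' => ?_⟩
    have low (a : ℕ) (ha : a ≤ c + N) := ih (c + N) v v' _ _ (fun i => left (h i))
      (snoc (a := ⟨a⟩) (a' := ⟨a⟩) (fun i => left (h' i)) (.inl ⟨ha, rfl⟩))
    have high (a : ℕ) (ha : c + N ≤ a) := ih c v v' _ _ (fun i => (h i).mono (by omega))
      (snoc (a := ⟨a⟩) (a' := ⟨a + 1⟩) (fun i => (h' i).mono (by omega)) (.inr ⟨ha, rfl⟩))
    constructor
    · rintro H ⟨b⟩
      obtain hb | hb := le_or_gt b (c + N)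
      · exact (low b hb).1 (H _)
      -- Every number above c + N is the successor of one that is at least c + N, so each element
      -- has a partner in this direction too.
      · obtain ⟨a, rfl⟩ := Nat.exists_eq_add_of_lt hb
        exact (high _ (by omega)).1 (H _)
    · rintro H ⟨a⟩
      obtain ha | ha := le_or_gt a (c + N)
      · exact (low a ha).2 (H _)
      · exact (high a ha.le).2 (H _)
  | inf f ih =>
    obtain ⟨N, ih⟩ := ih hσ
    refine ⟨2 * N, fun c v v' xs xs' h h' => ?_⟩
    -- Only large elements affect infinitude, and a shift by one does not change it.
    have high (a : ℕ) (ha : c + N ≤ a) := ih c v v' _ _ (fun i => (h i).mono (by omega))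
      (snoc (a := ⟨a⟩) (a' := ⟨a + 1⟩) (fun i => (h' i).mono (by omega)) (.inr ⟨ha, rfl⟩))
    have down (s : Set (ULift.{w} ℕ)) :
        s.Infinite ↔ ∃ᶠ a in Filter.atTop, (⟨a⟩ : ULift.{w} ℕ) ∈ s := by
      rw [Nat.frequently_atTop_iff_infinite]
      have hs : {a | (⟨a⟩ : ULift.{w} ℕ) ∈ s} = ULift.down '' s :=
        Set.ext fun a => ⟨fun h => ⟨_, h, rfl⟩, by rintro ⟨b, hb, rfl⟩; exact hb⟩
      rw [hs, Set.infinite_image_iff ULift.down_injective.injOn]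
    have shift (p : ℕ → Prop) :
        (∃ᶠ a in Filter.atTop, p a) ↔ ∃ᶠ a in Filter.atTop, p (a + 1) := by
      rw [← Filter.frequently_map (m := (· + 1)), Filter.map_add_atTop_eq_nat]
    simp only [BoundedFormula.Realize]
    rw [down, down, shift fun a => (⟨a⟩ : ULift.{w} ℕ) ∈ {b | f.Realize A v' (Fin.snoc xs' b)}]
    refine Filter.frequently_congr ?_
    filter_upwards [Filter.eventually_ge_atTop (c + N)] with a ha using high a ha

/-- Zero has no immediate predecessor and a + 1 has only a, so membership alternates from 0. -/
theorem isKernel_even :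
    IsKernel (fun a b : ULift.{w} ℕ => a.down < b.down) fun a => Even a.down := by
  have hfin : FinitaryOrder fun a b : ULift.{w} ℕ => a.down < b.down :=
    ⟨fun _ => lt_irrefl _, fun _ _ _ => lt_trans, fun a =>
      (Set.finite_Iio a.down).preimage ULift.down_injective.injOn⟩
  rintro ⟨a⟩
  refine ⟨fun ha => ⟨hfin, ?_⟩, fun h => ?_⟩
  · rintro ⟨b⟩ ⟨hb, hba⟩ hb'
    have := hba ⟨b + 1⟩ (Nat.lt_succ_self b)
    obtain rfl : a = b + 1 := by
      dsimp only at *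
      omega
    simp_all [Nat.even_add_one]
  · cases a with
    | zero => exact Even.zero
    | succ a =>
      have := h.2 ⟨a⟩ ⟨Nat.lt_succ_self a, fun ⟨c⟩ h₁ h₂ => by dsimp only at *; omega⟩
      simpa [Nat.even_add_one] using this

theorem not_explicitlyDefines_kernelSentence (R : L.Relations 2) (P : L.Relations 1) :
    ¬ ExplicitlyDefines.{u, v, w} (kernelSentence R P) P := by
  rintro ⟨θ, hθ, H⟩
  -- `θ` may use symbols absent from the sentence; trivial interpretations keep them from adding
  -- expressive power.
  let A₀ : L.Structure (ULift.{w} ℕ) := ⟨fun _ _ => ⟨0⟩, fun _ _ => False⟩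
  let A₁ := withRel A₀ R fun xs => (xs 0).down < (xs 1).down
  let A := withRel A₁ P fun xs => Even (xs 0).down
  have hA : Sentence.Realize A (kernelSentence R P) := by
    refine isKernel_withRel A₁ R P (p := fun a => Even a.down) ?_
    simp only [A₁, withRel_relMap_self]
    exact isKernel_even
  obtain ⟨N, hN⟩ := exists_shift_realize_iff (A := A) (σ := {relSymbol P}ᶜ) (fun _ _ => rfl)
    (fun {l} r hr xs ys h => by
      rw [withRel_relMap_of_ne _ _ _ hr, withRel_relMap_of_ne _ _ _ hr]
      by_cases hR : relSymbol r = relSymbol R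
      · obtain rfl : l = 2 := congrArg Sigma.fst (Sum.inr.inj hR)
        obtain rfl : r = R := by simpa [relSymbol] using hR
        rw [withRel_relMap_self, withRel_relMap_self]
        exact h 0 1
      · rw [withRel_relMap_of_ne _ _ _ hR, withRel_relMap_of_ne _ _ _ hR]
        exact Iff.rfl)
    θ (Set.subset_compl_singleton_iff.2 hθ)
  -- With cutoff 0, the points N and N + 1 are shift-related but differ in parity.
  have key := hN 0 (fun _ => ⟨N⟩) (fun _ => ⟨N + 1⟩) Fin.elim0 Fin.elim0
    (fun _ => .inr ⟨(Nat.zero_add N).le, rfl⟩) fun i => i.elim0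
  have key' := (H _ A hA _).trans (key.trans (H _ A hA _).symm)
  rw [withRel_relMap_self, withRel_relMap_self] at key'
  simp [Nat.even_add_one, -Nat.not_even_iff_odd] at key'

end Undefinability

end LQ0

theorem mainTheorem7 (L : FirstOrder.Language.{u, v})
    [∀ n, Infinite (L.Functions n)] [∀ n, Infinite (L.Relations n)] :
    ¬ LQ0.WeakBeth.{u, v, w} L := by
  intro h
  obtain ⟨R⟩ : Nonempty (L.Relations 2) := inferInstance
  obtain ⟨P⟩ : Nonempty (L.Relations 1) := inferInstance
  exact LQ0.not_explicitlyDefines_kernelSentence R P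
    (h 1 P _ (LQ0.relSymbol_mem_vocab_kernelSentence R P).2
      (LQ0.implicitlyDefines_kernelSentence R P) (LQ0.everyReductExpands_kernelSentence R P))
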